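/- Let $D\subset\mathbb{C}$ be a bounded domain (open and connected), let $H_s(D)$ be the space of real-valued $C^\infty$ functions compactly supported in $D$ (extended by $0$ outside $D$), with the Dirichlet inner product $(f,g)_\nabla=\frac1{2\pi}\int_D\nabla f\cdot\nabla g\,dx$, and let $H(D)$ be its Hilbert space completion. Let $h$ be an instance of the Gaussian free field on $D$ with zero boundary conditions, defined on a probability space $(\Omega,P)$: a family of jointly Gaussian, centred random variables $(h,f)_\nabla$, $f\in H(D)$, with $\mathrm{Cov}((h,f)_\nabla,(h,g)_\nabla)=(f,g)_\nabla$. For a measure $\mu$ of finite energy let $-\Delta^{-1}\mu$ be the element $f\in H(D)$ with $2\pi(f,\varphi)_\nabla=\int\varphi\,d\mu$ for all $\varphi\in H_s(D)$ (the weak solution of $-\Delta f=\mu$ with zero boundary values), and put $(h,\mu)=2\pi(h,-\Delta^{-1}\mu)_\nabla$. For $z\in\mathbb{C}$ and $\varepsilon>0$ let $h_\varepsilon(z)=(h,\rho_\varepsilon^z)$, where $\rho_\varepsilon^z$ is the uniform probability measure on the circle $\partial B_\varepsilon(z)$; this is the mean value of $h$ on that circle. Fix $z\in D$ and let $t_0=\inf\{t\in\mathbb{R}:B_{e^{-t}}(z)\subset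 D\}$. Then $V_t:=h_{e^{-(t_0+t)}}(z)-h_{e^{-t_0}}(z)$, $t\ge0$, is a standard Brownian motion. Precisely: 1. the process $t\mapsto h_{e^{-t}}(z)$, $t\in\mathbb{R}$, has a modification $\mathcal V$ all of whose paths are continuous on $[t_0,\infty)$ and for which $(\mathcal V_{t_0+t}-\mathcal V_{t_0})_{t\ge0}$ is a standard Brownian motion (with almost surely continuous paths); 2. for every modification $\mathcal V$ of $t\mapsto h_{e^{-t}}(z)$, the process $(\mathcal V_{t_0+t}-\mathcal V_{t_0})_{t\ge0}$ has the finite-dimensional distributions of standard Brownian motion, and if almost every path of $\mathcal V$ is continuous on $[t_0,\infty)$, then it is a standard Brownian motion. -/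

import Mathlib

open MeasureTheory ProbabilityTheory Filter Topology Set
open scoped NNReal ENNReal Gradient

noncomputable section

namespace PlanarGFF

/-- The vector space of real-valued `C^∞` functions with compact support contained in `D`,
each regarded as a function on the whole plane (so it vanishes outside `D`). -/
def testSubmodule (D : Set ℂ) : Submodule ℝ (ℂ → ℝ) where
  carrier := {f | ContDiff ℝ (⊤ : ℕ∞) f ∧ HasCompactSupport f ∧ tsupport f ⊆ D}
  add_mem' := by
    rintro f g ⟨hf, hf', hfD⟩ ⟨hg, hg', hgD⟩
    exact ⟨hf.add hg, hf'.add hg', (tsupport_add f g).trans (union_subset hfD hgD)⟩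
  zero_mem' := ⟨contDiff_const, HasCompactSupport.zero, by simp [tsupport]⟩
  smul_mem' := by
    rintro c f ⟨hf, hf', hfD⟩
    refine ⟨contDiff_const.smul hf, hf'.smul_left, ?_⟩
    exact (tsupport_smul_subset_right (fun _ => c) f).trans hfD

/-- The space `H_s(D)` of test functions. It is a separate type, so that it carries only the
topology of the Dirichlet norm below, and not that of pointwise convergence. -/
def TestFun (D : Set ℂ) : Type := ↥(testSubmodule D)

namespace TestFun

variable {D : Set ℂ}

instance : AddCommGroup (TestFun D) := inferInstanceAs (AddCommGroup ↥(testSubmodule D))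

instance : Module ℝ (TestFun D) := inferInstanceAs (Module ℝ ↥(testSubmodule D))

/-- A test function as a function on the plane. -/
def toFun (f : TestFun D) : ℂ → ℝ := f.1

instance : CoeFun (TestFun D) (fun _ => ℂ → ℝ) := ⟨toFun⟩

theorem coe_add (f g : TestFun D) : ⇑(f + g) = ⇑f + ⇑g := rfl

theorem coe_smul (c : ℝ) (f : TestFun D) : ⇑(c • f) = c • ⇑f := rfl

theorem contDiff (f : TestFun D) : ContDiff ℝ (⊤ : ℕ∞) ⇑f := f.2.1

theorem hasCompactSupport (f : TestFun D) : HasCompactSupport ⇑f := f.2.2.1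

theorem tsupport_subset (f : TestFun D) : tsupport ⇑f ⊆ D := f.2.2.2

theorem differentiable (f : TestFun D) : Differentiable ℝ ⇑f :=
  f.contDiff.differentiable (by simp)

theorem continuous_gradient (f : TestFun D) : Continuous (∇ ⇑f) :=
  (InnerProductSpace.toDual ℝ ℂ).symm.continuous.comp (f.contDiff.continuous_fderiv (by simp))

theorem hasCompactSupport_gradient (f : TestFun D) : HasCompactSupport (∇ ⇑f) :=
  (f.hasCompactSupport.fderiv (𝕜 := ℝ)).comp_left
    (g := (InnerProductSpace.toDual ℝ ℂ).symm) (map_zero _)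

theorem gradient_add (f g : TestFun D) (x : ℂ) :
    ∇ ⇑(f + g) x = ∇ ⇑f x + ∇ ⇑g x := by
  rw [coe_add, gradient, gradient, gradient,
    fderiv_add f.differentiable.differentiableAt g.differentiable.differentiableAt, map_add]

theorem gradient_smul (c : ℝ) (f : TestFun D) (x : ℂ) :
    ∇ ⇑(c • f) x = c • ∇ ⇑f x := by
  rw [coe_smul, gradient, gradient, fderiv_const_smul f.differentiable.differentiableAt]
  simp

/-- The Dirichlet inner product `(f, g)_∇ = (2π)⁻¹ ∫_D ∇f · ∇g` on test functions. -/
def dirichlet (f g : TestFun D) : ℝ :=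
  (2 * Real.pi)⁻¹ * ∫ x in D, inner ℝ (∇ ⇑f x) (∇ ⇑g x)

theorem integrable_inner_gradient (f g : TestFun D) :
    Integrable (fun x => inner ℝ (∇ ⇑f x) (∇ ⇑g x)) (volume : Measure ℂ) := by
  refine (f.continuous_gradient.inner g.continuous_gradient).integrable_of_hasCompactSupport ?_
  refine f.hasCompactSupport_gradient.mono ?_
  intro x hx h0
  exact hx (by simp [h0])

theorem gradient_eq_zero_of_notMem (f : TestFun D) {x : ℂ} (hx : x ∉ D) : ∇ ⇑f x = 0 := by
  have h : fderiv ℝ ⇑f x = 0 := by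
    by_contra h
    exact hx (f.tsupport_subset (support_fderiv_subset ℝ (f := ⇑f) h))
  rw [gradient, h, map_zero]

theorem eq_zero_of_dirichlet_self (f : TestFun D) (h : dirichlet f f = 0) : f = 0 := by
  have hset : ∫ x in D, inner ℝ (∇ ⇑f x) (∇ ⇑f x)
      = ∫ x, inner ℝ (∇ ⇑f x) (∇ ⇑f x) := by
    refine setIntegral_eq_integral_of_forall_compl_eq_zero fun x hx => ?_
    simp [f.gradient_eq_zero_of_notMem hx]
  have h0 : ∫ x, inner ℝ (∇ ⇑f x) (∇ ⇑f x) = 0 := by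
    rw [dirichlet, hset] at h
    exact (mul_eq_zero.1 h).resolve_left (by positivity)
  have h1 := fun x : ℂ => (Continuous.integral_pos_of_hasCompactSupport_nonneg_nonzero (x := x)
    (μ := (volume : Measure ℂ)) (f := fun x => inner ℝ (∇ ⇑f x) (∇ ⇑f x))
    (f.continuous_gradient.inner f.continuous_gradient)
    (f.hasCompactSupport_gradient.mono fun x hx h0 => hx (by simp [h0]))
    (fun x => real_inner_self_nonneg))
  have hgrad : ∀ x, ∇ ⇑f x = 0 := by
    intro x
    by_contra hx
    exact (h1 x (by simpa using hx)).ne' h0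
  have hfd : ∀ x, fderiv ℝ ⇑f x = 0 := fun x => by
    have := hgrad x
    rwa [gradient, LinearIsometryEquiv.map_eq_zero_iff] at this
  have hconst : ∀ x y, f x = f y := is_const_of_fderiv_eq_zero f.differentiable hfd
  obtain ⟨y, hy⟩ : ∃ y, f y = 0 := by
    by_contra! hne
    have : tsupport ⇑f = univ :=
      eq_univ_of_univ_subset fun x _ => subset_tsupport _ (hne x)
    have hc := f.hasCompactSupport
    rw [HasCompactSupport, this] at hc
    exact noncompact_univ ℂ hc
  exact Subtype.ext (funext fun x => (hconst x y).trans hy)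

/-- The Dirichlet form is an inner product on test functions. -/
@[reducible]
def core (D : Set ℂ) : InnerProductSpace.Core ℝ (TestFun D) where
  inner f g := dirichlet f g
  conj_inner_symm f g := by
    simp only [dirichlet, conj_trivial]
    congr 1
    exact integral_congr_ae (ae_of_all _ fun x => real_inner_comm _ _)
  re_inner_nonneg f := by
    refine mul_nonneg (by positivity) (integral_nonneg fun x => ?_)
    exact real_inner_self_nonneg
  add_left f g k := by
    simp only [dirichlet, gradient_add, inner_add_left]
    rw [integral_add (integrable_inner_gradient f k).integrableOn
      (integrable_inner_gradient g k).integrableOn, mul_add]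
  smul_left f g c := by
    simp only [dirichlet, gradient_smul, real_inner_smul_left, integral_const_mul, conj_trivial]
    ring
  definite f h := eq_zero_of_dirichlet_self f h

instance : NormedAddCommGroup (TestFun D) := (core D).toNormedAddCommGroup

instance : InnerProductSpace ℝ (TestFun D) := InnerProductSpace.ofCore (core D).toCore

theorem inner_eq (f g : TestFun D) :
    inner ℝ f g = (2 * Real.pi)⁻¹ * ∫ x in D, inner ℝ (∇ ⇑f x) (∇ ⇑g x) := rfl

end TestFun

/-- The Hilbert space `H(D)`: the completion of the test functions for the Dirichlet norm. -/
abbrev DirichletSpace (D : Set ℂ) : Type := UniformSpace.Completion (TestFun D)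

/-- `h` is an instance of the Gaussian free field on `D` with zero boundary conditions (a standard
Gaussian on `H(D)`), where `h f` is the random variable `(h, f)_∇`: these variables are jointly
Gaussian, centred, and `Cov((h, f)_∇, (h, g)_∇) = (f, g)_∇`. -/
structure IsGFF {D : Set ℂ} {Ω : Type*} [MeasurableSpace Ω]
    (h : DirichletSpace D → Ω → ℝ) (P : Measure Ω) : Prop where
  gaussian : IsGaussianProcess h P
  mean_zero : ∀ f, ∫ ω, h f ω ∂P = 0
  covariance : ∀ f g, cov[h f, h g; P] = inner ℝ f g

/-- `f = -Δ⁻¹ μ`: the element `f` of `H(D)` solves `-Δ f = μ` in `D` in the weak sense, that is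
`2π (f, φ)_∇ = ∫ φ dμ` for every test function `φ`. -/
def IsNegInvLaplacian {D : Set ℂ} (μ : Measure ℂ) (f : DirichletSpace D) : Prop :=
  ∀ φ : TestFun D, 2 * Real.pi * inner ℝ f (φ : DirichletSpace D) = ∫ x, φ x ∂μ

/-- At most one element of `H(D)` is a weak solution. -/
theorem IsNegInvLaplacian.unique {D : Set ℂ} {μ : Measure ℂ} {f g : DirichletSpace D}
    (hf : IsNegInvLaplacian μ f) (hg : IsNegInvLaplacian μ g) : f = g := by
  refine ext_inner_right ℝ fun v => ?_
  induction v using UniformSpace.Completion.induction_on with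
  | hp => exact isClosed_eq (by fun_prop) (by fun_prop)
  | ih φ => exact mul_left_cancel₀ (by positivity) ((hf φ).trans (hg φ).symm)

open Classical in
/-- `-Δ⁻¹ μ` as an element of `H(D)` (zero if `μ` has infinite energy, when there is none). -/
def negInvLaplacian (D : Set ℂ) (μ : Measure ℂ) : DirichletSpace D :=
  if h : ∃ f : DirichletSpace D, IsNegInvLaplacian μ f then h.choose else 0

/-- The pairing `(h, μ) = 2π (h, -Δ⁻¹ μ)_∇` of the field with a measure. -/
def pairing {D : Set ℂ} {Ω : Type*} (h : DirichletSpace D → Ω → ℝ) (μ : Measure ℂ) (ω : Ω) : ℝ :=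
  2 * Real.pi * h (negInvLaplacian D μ) ω

/-- The uniform probability measure on the circle `∂B_ε(z)`. -/
def circleMeasure (z : ℂ) (ε : ℝ) : Measure ℂ :=
  ENNReal.ofReal (2 * Real.pi)⁻¹ •
    (volume.restrict (Ioc 0 (2 * Real.pi))).map (circleMap z ε)

/-- `h_ε(z)`: the mean value of the field on the circle of radius `ε` about `z`. -/
def circleMean {D : Set ℂ} {Ω : Type*} (h : DirichletSpace D → Ω → ℝ) (z : ℂ) (ε : ℝ) (ω : Ω) :
    ℝ :=
  pairing h (circleMeasure z ε) ω

/-- `𝒱` is a version (modification) of the process `t ↦ h_{e^{-t}}(z)`. -/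
def IsCircleMeanVersion {D : Set ℂ} {Ω : Type*} [MeasurableSpace Ω]
    (h : DirichletSpace D → Ω → ℝ) (P : Measure Ω) (z : ℂ) (𝒱 : ℝ → Ω → ℝ) : Prop :=
  ∀ t : ℝ, 𝒱 t =ᵐ[P] circleMean h z (Real.exp (-t))

/-- `t₀ = inf {t : B_{e^{-t}}(z) ⊂ D}`. -/
def firstTime (D : Set ℂ) (z : ℂ) : ℝ :=
  sInf {t : ℝ | Metric.ball z (Real.exp (-t)) ⊆ D}

end PlanarGFF

end

/-!
The mean of the field on the circle of radius `e⁻ᵗ` is the field paired with the potential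
`circlePotential D z t`, which exists in `H(D)` by the Riesz representation theorem: the mean of a
test function over a circle is bounded by its Dirichlet norm, as one sees by comparing with a
concentric circle outside the bounded set `D`
(`PlanarGFF.exists_isNegInvLaplacian_circleMeasure`).

Everything rests on the identity `‖G t - G s‖² = t - s` for `t₀ ≤ s ≤ t`, where `G` is this
potential (`PlanarGFF.norm_circlePotential_sub_sq`). By duality, `‖G t - G s‖` is the norm of the
functional "difference of the means over the two circles". The upper bound is the Cauchy-Schwarz
inequality for the radial derivative on the annulus between the circles, in polar coordinates
(`sq_circleAverage_sub_le`). The lower bound comes from smooth radial test functions, constant near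
the inner disc and vanishing near the outer circle, which approximate the logarithm
(`PlanarGFF.TestFun.exists_norm_sq_le_circleAverage_sub`). These are compactly supported in the open
disc bounded by the outer circle, so it does not matter that for `s = t₀` this circle meets the
boundary of `D`; no explicit Green function is needed.

By polarization the increments of the circle means from time `t₀` on have covariance `min s t`. They
form a centred Gaussian process, hence a pre-Brownian motion
(`PlanarGFF.IsGFF.isPreBrownianReal_circleMean`). The continuous version is the classical one: values
along dyadic approximations of `t` converge, by fourth moments of Gaussian increments and the
Borel-Cantelli lemma (`ProbabilityTheory.IsPreBrownianReal.exists_continuous_modification`).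
-/

/-! ### Continuous modifications of pre-Brownian motions -/

/-- The largest multiple of `2⁻ⁿ` which is at most `t`. -/
noncomputable def dyadicFloor (n : ℕ) (t : ℝ≥0) : ℝ≥0 := ⌊2 ^ n * t⌋₊ / 2 ^ n

theorem dyadicFloor_le (n : ℕ) (t : ℝ≥0) : dyadicFloor n t ≤ t := by
  rw [dyadicFloor, div_le_iff₀ (by positivity), mul_comm t]
  exact Nat.floor_le (by positivity)

theorem sub_dyadicFloor_le (n : ℕ) (t : ℝ≥0) : (t : ℝ) - dyadicFloor n t ≤ (1 / 2) ^ n := by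
  have h : (2 : ℝ≥0) ^ n * t < ⌊2 ^ n * t⌋₊ + 1 := Nat.lt_floor_add_one _
  have h' : (2 : ℝ) ^ n * t < ⌊2 ^ n * t⌋₊ + 1 := by exact_mod_cast h
  rw [dyadicFloor]
  push_cast
  have h2 : (0 : ℝ) < 2 ^ n := by positivity
  rw [one_div, inv_pow, sub_le_iff_le_add, inv_eq_one_div, ← add_div, le_div_iff₀ h2]
  linarith

/-- Consecutive dyadic approximations of `t` coincide or are neighbours on the finer grid. -/
theorem dist_dyadicFloor_succ_le {x : ℝ≥0 → ℝ} {n : ℕ} {c : ℝ} {t : ℝ≥0} (hc : 0 ≤ c) (ht : t < n)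
    (hx : ∀ k < (n + 1) * 2 ^ (n + 1),
      |x ((k + 1 : ℕ) / 2 ^ (n + 1)) - x ((k : ℕ) / 2 ^ (n + 1))| ≤ c) :
    dist (x (dyadicFloor n t)) (x (dyadicFloor (n + 1) t)) ≤ c := by
  have h1 : ⌊(2 : ℝ≥0) ^ n * t⌋₊ = ⌊(2 : ℝ≥0) ^ (n + 1) * t⌋₊ / 2 := by
    rw [← Nat.floor_div_natCast]
    congr 1
    rw [pow_succ]
    push_cast
    field_simp
  have hm : ⌊(2 : ℝ≥0) ^ (n + 1) * t⌋₊ < (n + 1) * 2 ^ (n + 1) := by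
    rw [Nat.floor_lt (by positivity)]
    push_cast
    rw [mul_comm]
    gcongr
    exact ht.trans (by exact_mod_cast Nat.lt_succ_self n)
  set m := ⌊(2 : ℝ≥0) ^ (n + 1) * t⌋₊ with hmdef
  have h2 : dyadicFloor n t = ((2 * (m / 2) : ℕ) : ℝ≥0) / 2 ^ (n + 1) := by
    rw [dyadicFloor, h1, pow_succ]
    push_cast
    field_simp
  have h3 : dyadicFloor (n + 1) t = (m : ℝ≥0) / 2 ^ (n + 1) := rfl
  rw [h2, h3]
  rcases Nat.even_or_odd' m with ⟨k, hk | hk⟩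
  · rw [show 2 * (m / 2) = m by omega, dist_self]
    exact hc
  · have h4 : 2 * (m / 2) = 2 * k := by omega
    rw [h4, hk, dist_comm, Real.dist_eq]
    exact hx (2 * k) (by omega)

/-- Points at distance less than `2⁻ⁿ` have dyadic approximations which coincide or are
neighbours. -/
theorem dist_dyadicFloor_le {x : ℝ≥0 → ℝ} {n : ℕ} {c : ℝ} {s t : ℝ≥0} (hc : 0 ≤ c)
    (hs : s < n) (ht : t < n) (hst : dist s t < (1 / 2) ^ n)
    (hx : ∀ k < n * 2 ^ n, |x ((k + 1 : ℕ) / 2 ^ n) - x ((k : ℕ) / 2 ^ n)| ≤ c) :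
    dist (x (dyadicFloor n s)) (x (dyadicFloor n t)) ≤ c := by
  wlog hle : s ≤ t generalizing s t
  · rw [dist_comm]
    exact this ht hs (by rwa [dist_comm]) (le_of_not_ge hle)
  have hlt : t < s + (1 / 2) ^ n := by
    rw [dist_comm, NNReal.dist_eq] at hst
    have : (t : ℝ) < s + (1 / 2) ^ n := by linarith [(abs_lt.1 hst).2]
    exact_mod_cast this
  have hk1 : ⌊(2 : ℝ≥0) ^ n * s⌋₊ ≤ ⌊(2 : ℝ≥0) ^ n * t⌋₊ := by gcongr
  have hk2 : ⌊(2 : ℝ≥0) ^ n * t⌋₊ ≤ ⌊(2 : ℝ≥0) ^ n * s⌋₊ + 1 := by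
    rw [← Nat.floor_add_one (by positivity)]
    apply Nat.floor_le_floor
    calc (2 : ℝ≥0) ^ n * t ≤ 2 ^ n * (s + (1 / 2) ^ n) := by gcongr
      _ = 2 ^ n * s + 1 := by
        rw [mul_add, ← mul_pow]
        norm_num
  have hm : ⌊(2 : ℝ≥0) ^ n * s⌋₊ < n * 2 ^ n := by
    rw [Nat.floor_lt (by positivity)]
    push_cast
    rw [mul_comm]
    gcongr
  rw [dyadicFloor, dyadicFloor]
  rcases (show ⌊(2 : ℝ≥0) ^ n * t⌋₊ = ⌊(2 : ℝ≥0) ^ n * s⌋₊ ∨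
    ⌊(2 : ℝ≥0) ^ n * t⌋₊ = ⌊(2 : ℝ≥0) ^ n * s⌋₊ + 1 by omega) with h | h
  · rw [h, dist_self]
    exact hc
  · rw [h, dist_comm, Real.dist_eq]
    exact hx _ hm

/-- If the increments of `x` over the grid of mesh `2⁻ⁿ` decay geometrically, locally uniformly,
then the values of `x` at dyadic approximations converge to a continuous function. -/
theorem exists_continuous_tendsto_dyadicFloor {x : ℝ≥0 → ℝ} {r : ℝ} (hr0 : 0 < r) (hr1 : r < 1)
    (hx : ∀ᶠ n : ℕ in atTop, ∀ k < n * 2 ^ n,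
      |x ((k + 1 : ℕ) / 2 ^ n) - x ((k : ℕ) / 2 ^ n)| ≤ r ^ n) :
    ∃ y : ℝ≥0 → ℝ, Continuous y ∧
      ∀ t, Tendsto (fun n => x (dyadicFloor n t)) atTop (𝓝 (y t)) := by
  obtain ⟨n₀, hn₀⟩ := eventually_atTop.1 hx
  have hstep : ∀ t : ℝ≥0, ∀ N ≥ n₀, t < N → ∀ n,
      dist (x (dyadicFloor (n + N) t)) (x (dyadicFloor (n + 1 + N) t)) ≤ r ^ N * r ^ n := by
    intro t N hN ht n
    have h1 : t < ((n + N : ℕ) : ℝ≥0) := ht.trans_le (by exact_mod_cast Nat.le_add_left N n)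
    have := dist_dyadicFloor_succ_le (x := x) (c := r ^ (n + N + 1)) (by positivity) h1
      (hn₀ (n + N + 1) (by omega))
    rw [show n + 1 + N = n + N + 1 by ring]
    refine this.trans ?_
    rw [← pow_add]
    exact pow_le_pow_of_le_one hr0.le hr1.le (by omega)
  have hlim : ∀ t : ℝ≥0, ∃ a, Tendsto (fun n => x (dyadicFloor n t)) atTop (𝓝 a) := by
    intro t
    obtain ⟨N, hN⟩ := exists_nat_gt t
    have hN' : t < ((max n₀ N : ℕ) : ℝ≥0) := hN.trans_le (by exact_mod_cast le_max_right _ _)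
    obtain ⟨a, ha⟩ := cauchySeq_tendsto_of_complete
      (cauchySeq_of_le_geometric r _ hr1 (hstep t (max n₀ N) (le_max_left _ _) hN'))
    exact ⟨a, (tendsto_add_atTop_iff_nat (f := fun n => x (dyadicFloor n t)) _).1 ha⟩
  choose y hy using hlim
  have hdist : ∀ t : ℝ≥0, ∀ N ≥ n₀, t < N →
      dist (x (dyadicFloor N t)) (y t) ≤ r ^ N / (1 - r) := by
    intro t N hN ht
    have := dist_le_of_le_geometric_of_tendsto r _ hr1 (hstep t N hN ht)
      ((tendsto_add_atTop_iff_nat (f := fun n => x (dyadicFloor n t)) N).2 (hy t)) 0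
    simpa using this
  refine ⟨y, ?_, hy⟩
  rw [Metric.continuous_iff]
  intro t ε hε
  have hlim0 : Tendsto (fun N : ℕ => r ^ N * (1 + 2 / (1 - r))) atTop (𝓝 0) := by
    simpa using (tendsto_pow_atTop_nhds_zero_of_lt_one hr0.le hr1).mul_const (1 + 2 / (1 - r))
  obtain ⟨M, hM⟩ := exists_nat_gt (t + 1)
  obtain ⟨N, hNε, hN⟩ :=
    ((hlim0.eventually (gt_mem_nhds hε)).and (eventually_ge_atTop (max n₀ M))).exists
  have hNn : n₀ ≤ N := (le_max_left _ _).trans hN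
  have hNM : (M : ℝ≥0) ≤ N := by exact_mod_cast (le_max_right _ _).trans hN
  have htN : t < N := (lt_add_of_pos_right t one_pos).trans (hM.trans_le hNM)
  refine ⟨(1 / 2) ^ N, by positivity, fun s hs => ?_⟩
  have hsN : s < N := by
    have h1 : dist s t < 1 := hs.trans_le (pow_le_one₀ (by norm_num) (by norm_num))
    rw [NNReal.dist_eq] at h1
    have h2 : (s : ℝ) < t + 1 := by linarith [(abs_lt.1 h1).2]
    have h3 : s < t + 1 := by exact_mod_cast h2
    exact h3.trans (hM.trans_le hNM)
  have h1 := dist_dyadicFloor_le (x := x) (by positivity) hsN htN hs (hn₀ N hNn)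
  have h2 := hdist s N hNn hsN
  have h3 := hdist t N hNn htN
  calc dist (y s) (y t) ≤ dist (y s) (x (dyadicFloor N s)) +
        dist (x (dyadicFloor N s)) (x (dyadicFloor N t)) + dist (x (dyadicFloor N t)) (y t) :=
        dist_triangle4 _ _ _ _
    _ ≤ r ^ N / (1 - r) + r ^ N + r ^ N / (1 - r) := by
        rw [dist_comm (y s)]
        gcongr
    _ = r ^ N * (1 + 2 / (1 - r)) := by ring
    _ < ε := hNε

/-- A Markov inequality with fourth moments, uniform over centred Gaussians of given variance. -/
theorem exists_gaussianReal_tail_le :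
    ∃ M : ℝ≥0, ∀ (v : ℝ≥0) (a : ℝ), 0 < a →
      gaussianReal 0 v {x | a < |x|} ≤ ENNReal.ofReal (M * (v : ℝ) ^ 2 / a ^ 4) := by
  set I : ℝ≥0∞ := ∫⁻ x, ‖x‖ₑ ^ 4 ∂(gaussianReal 0 1) with hI
  have hfin : I ≠ ∞ := by
    have h := (memLp_id_gaussianReal (μ := 0) (v := 1) 4).eLpNorm_lt_top
    rw [eLpNorm_lt_top_iff_lintegral_rpow_enorm_lt_top (by norm_num) (by norm_num)] at h
    rw [hI]
    have h4 : (((4 : ℝ≥0) : ℝ≥0∞)).toReal = ((4 : ℕ) : ℝ) := by norm_num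
    simp only [h4, ENNReal.rpow_natCast, id_eq] at h
    exact h.ne
  refine ⟨I.toNNReal, fun v a ha => ?_⟩
  have hmap : gaussianReal 0 v = (gaussianReal 0 1).map (fun x => √v * x) := by
    rw [gaussianReal_map_const_mul]
    congr 1
    · simp
    · ext
      simp
  have hmeas : MeasurableSet {x : ℝ | a < |x|} := measurableSet_lt measurable_const (by fun_prop)
  rw [hmap, Measure.map_apply (by fun_prop) hmeas]
  have hsub : (fun x : ℝ => √v * x) ⁻¹' {x | a < |x|} ⊆
      {x | ENNReal.ofReal (a ^ 4) ≤ ENNReal.ofReal ((v : ℝ) ^ 2) * ‖x‖ₑ ^ 4} := by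
    intro x hx
    have hx' : a < |√v * x| := hx
    simp only [mem_ofPred_eq]
    rw [← ofReal_norm, ← ENNReal.ofReal_pow (norm_nonneg _),
      ← ENNReal.ofReal_mul (by positivity)]
    apply ENNReal.ofReal_le_ofReal
    have h1 : a ^ 4 ≤ |√v * x| ^ 4 := by gcongr
    rw [abs_mul, mul_pow, abs_of_nonneg (Real.sqrt_nonneg _)] at h1
    have h2 : √(v : ℝ) ^ 4 = (v : ℝ) ^ 2 := by
      rw [show 4 = 2 * 2 by norm_num, pow_mul, Real.sq_sqrt v.coe_nonneg]
    rwa [h2] at h1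
  have hmarkov := meas_ge_le_lintegral_div (μ := gaussianReal 0 1)
    (f := fun x => ENNReal.ofReal ((v : ℝ) ^ 2) * ‖x‖ₑ ^ 4) (ε := ENNReal.ofReal (a ^ 4))
    (by fun_prop) (by simpa using by positivity) ENNReal.ofReal_ne_top
  refine (measure_mono hsub).trans (hmarkov.trans_eq ?_)
  rw [lintegral_const_mul _ (by fun_prop), ← hI, ENNReal.ofReal_div_of_pos (by positivity),
    ENNReal.ofReal_mul (by positivity), ENNReal.ofReal_coe_nnreal, ENNReal.coe_toNNReal hfin,
    mul_comm]

section

variable {Ω : Type*} [MeasurableSpace Ω] {P : Measure Ω} {X : ℝ≥0 → Ω → ℝ}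

/-- Over a time step of at most `2⁻ⁿ`, the chance that a pre-Brownian motion moves by more than
`(9/10)ⁿ` is so small that it stays summable after multiplication by the number `n 2ⁿ` of steps in
`[0, n]`. Any `c < 1` with `c⁴ > 1 / 2` could replace `9 / 10`, as the fourth moment of the increment
is of order `4⁻ⁿ`; here `2500 / 6561 = 4⁻¹ / (9 / 10)⁴`. -/
theorem ProbabilityTheory.IsPreBrownianReal.exists_measure_increment_le
    (hX : IsPreBrownianReal X P) :
    ∃ M : ℝ≥0, ∀ (n : ℕ) (s t : ℝ≥0), |(s : ℝ) - t| ≤ (1 / 2) ^ n →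
      P {ω | (9 / 10) ^ n < |X s ω - X t ω|} ≤ ENNReal.ofReal (M * (2500 / 6561) ^ n) := by
  obtain ⟨M, hM⟩ := exists_gaussianReal_tail_le
  refine ⟨M, fun n s t hst => ?_⟩
  have hmeas : MeasurableSet {x : ℝ | (9 / 10 : ℝ) ^ n < |x|} :=
    measurableSet_lt measurable_const (by fun_prop)
  have h := (hX.hasLaw_sub s t).measure_eq (p := fun x => (9 / 10 : ℝ) ^ n < |x|) hmeas
  simp only [Pi.sub_apply] at h
  rw [h]
  refine (hM _ _ (by positivity)).trans (ENNReal.ofReal_le_ofReal ?_)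
  rw [mul_div_assoc]
  gcongr
  have h2 : ((nndist (s : ℝ) (t : ℝ) : ℝ≥0) : ℝ) ≤ (1 / 2) ^ n := by
    rwa [coe_nndist, Real.dist_eq]
  rw [div_le_iff₀ (by positivity)]
  calc ((nndist (s : ℝ) (t : ℝ) : ℝ≥0) : ℝ) ^ 2 ≤ ((1 / 2) ^ n) ^ 2 := by gcongr
    _ = (2500 / 6561) ^ n * ((9 / 10) ^ n) ^ 4 := by
      rw [← pow_mul, ← pow_mul, mul_comm n 2, mul_comm n 4, pow_mul, pow_mul, ← mul_pow]
      norm_num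

/-- **Kolmogorov continuity for Brownian motion**: a pre-Brownian motion has a modification all of
whose paths are continuous. -/
theorem ProbabilityTheory.IsPreBrownianReal.exists_continuous_modification
    (hX : IsPreBrownianReal X P) :
    ∃ Y : ℝ≥0 → Ω → ℝ, (∀ ω, Continuous (Y · ω)) ∧ ∀ t, Y t =ᵐ[P] X t := by
  obtain ⟨M, hM⟩ := hX.exists_measure_increment_le
  have hgrid : ∀ᵐ ω ∂P, ∀ᶠ n : ℕ in atTop, ∀ k < n * 2 ^ n,
      |X ((k + 1 : ℕ) / 2 ^ n) ω - X ((k : ℕ) / 2 ^ n) ω| ≤ (9 / 10 : ℝ) ^ n := by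
    have hs : ∀ n : ℕ, P (⋃ k ∈ Finset.range (n * 2 ^ n),
        {ω | (9 / 10 : ℝ) ^ n < |X ((k + 1 : ℕ) / 2 ^ n) ω - X ((k : ℕ) / 2 ^ n) ω|}) ≤
        ENNReal.ofReal (M * ((n : ℝ) ^ 1 * (5000 / 6561) ^ n)) := by
      intro n
      refine (measure_biUnion_finset_le _ _).trans ?_
      refine (Finset.sum_le_card_nsmul _ _ (ENNReal.ofReal (M * (2500 / 6561) ^ n)) ?_).trans_eq ?_
      · intro k _
        refine hM n _ _ (le_of_eq ?_)
        push_cast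
        rw [← sub_div, add_sub_cancel_left, one_div, one_div, inv_pow, abs_of_pos (by positivity)]
      · rw [Finset.card_range, nsmul_eq_mul, ← ENNReal.ofReal_natCast,
          ← ENNReal.ofReal_mul (by positivity)]
        congr 1
        push_cast
        rw [show (5000 / 6561 : ℝ) = 2 * (2500 / 6561) by norm_num, mul_pow]
        ring
    have hnorm : ‖(5000 / 6561 : ℝ)‖ < 1 := by
      rw [Real.norm_of_nonneg (by norm_num)]
      norm_num
    have hsum := (summable_pow_mul_geometric_of_norm_lt_one 1 hnorm).mul_left (M : ℝ)
    have := ae_eventually_notMem (ne_top_of_le_ne_top hsum.tsum_ofReal_ne_top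
      (ENNReal.tsum_le_tsum hs))
    filter_upwards [this] with ω hω
    filter_upwards [hω] with n hn k hk
    simp only [Finset.mem_range, mem_iUnion, mem_ofPred_eq, not_exists, not_lt] at hn
    exact hn k hk
  have hpt : ∀ t, ∀ᵐ ω ∂P, Tendsto (fun n => X (dyadicFloor n t) ω) atTop (𝓝 (X t ω)) := by
    intro t
    have hs : ∀ n : ℕ, P {ω | (9 / 10 : ℝ) ^ n < |X (dyadicFloor n t) ω - X t ω|} ≤
        ENNReal.ofReal (M * (2500 / 6561) ^ n) := by
      intro n
      refine hM n _ _ ?_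
      rw [abs_sub_comm, abs_of_nonneg (sub_nonneg.2 (NNReal.coe_le_coe.2 (dyadicFloor_le n t)))]
      exact sub_dyadicFloor_le n t
    have hsum := (summable_geometric_of_lt_one (r := (2500 / 6561 : ℝ)) (by norm_num)
      (by norm_num)).mul_left (M : ℝ)
    have := ae_eventually_notMem (ne_top_of_le_ne_top hsum.tsum_ofReal_ne_top
      (ENNReal.tsum_le_tsum hs))
    filter_upwards [this] with ω hω
    rw [tendsto_iff_dist_tendsto_zero]
    refine squeeze_zero' (Eventually.of_forall fun n => dist_nonneg) ?_
      (tendsto_pow_atTop_nhds_zero_of_lt_one (r := (9 / 10 : ℝ)) (by norm_num) (by norm_num))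
    filter_upwards [hω] with n hn
    simpa [Real.dist_eq] using hn
  have hex : ∀ ω, ∃ y : ℝ≥0 → ℝ, Continuous y ∧
      ((∀ᶠ n : ℕ in atTop, ∀ k < n * 2 ^ n,
        |X ((k + 1 : ℕ) / 2 ^ n) ω - X ((k : ℕ) / 2 ^ n) ω| ≤ (9 / 10 : ℝ) ^ n) →
      ∀ t, Tendsto (fun n => X (dyadicFloor n t) ω) atTop (𝓝 (y t))) := by
    intro ω
    by_cases hω : ∀ᶠ n : ℕ in atTop, ∀ k < n * 2 ^ n,
        |X ((k + 1 : ℕ) / 2 ^ n) ω - X ((k : ℕ) / 2 ^ n) ω| ≤ (9 / 10 : ℝ) ^ n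
    · obtain ⟨y, hy, hy'⟩ := exists_continuous_tendsto_dyadicFloor (x := (X · ω))
        (by norm_num) (by norm_num) hω
      exact ⟨y, hy, fun _ => hy'⟩
    · exact ⟨0, continuous_zero, fun h => absurd h hω⟩
  choose y hy hy' using hex
  refine ⟨fun t ω => y ω t, hy, fun t => ?_⟩
  filter_upwards [hgrid, hpt t] with ω h1 h2
  exact tendsto_nhds_unique (hy' ω h1 t) h2

end

/-! ### Integration in polar coordinates -/

theorem polarCoord_symm_add_eq_circleMap (z : ℂ) (p : ℝ × ℝ) :
    Complex.polarCoord.symm p + z = circleMap z p.1 p.2 := by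
  rw [Complex.polarCoord_symm_apply, circleMap, Complex.exp_mul_I, add_comm]
  push_cast
  rfl

/-- The integral over an annulus about `z` in polar coordinates. -/
theorem setIntegral_annulus_eq {z : ℂ} {a b : ℝ} (ha : 0 ≤ a) (f : ℂ → ℝ) :
    ∫ w in {w : ℂ | ‖w - z‖ ∈ Ioc a b}, f w =
      ∫ p in Ioc a b ×ˢ Ioo (-Real.pi) Real.pi, p.1 * f (circleMap z p.1 p.2) := by
  have hA : MeasurableSet {w : ℂ | ‖w - z‖ ∈ Ioc a b} :=
    measurableSet_preimage (f := fun w : ℂ => ‖w - z‖) (by fun_prop) measurableSet_Ioc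
  have hS : MeasurableSet {p : ℝ × ℝ | p.1 ∈ Ioc a b} := measurable_fst measurableSet_Ioc
  rw [← integral_indicator hA, ← integral_add_right_eq_self _ z,
    ← Complex.integral_comp_polarCoord_symm]
  have h1 : ∀ p ∈ polarCoord.target,
      p.1 • ({w : ℂ | ‖w - z‖ ∈ Ioc a b}.indicator f (Complex.polarCoord.symm p + z)) =
      {p : ℝ × ℝ | p.1 ∈ Ioc a b}.indicator (fun p => p.1 * f (circleMap z p.1 p.2)) p := by
    intro p hp
    rw [polarCoord_target] at hp
    have hp1 : 0 < p.1 := hp.1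
    have h2 : ‖circleMap z p.1 p.2 - z‖ = p.1 := by
      rw [circleMap_sub_center, norm_circleMap_zero, abs_of_pos hp1]
    rw [polarCoord_symm_add_eq_circleMap]
    by_cases h : p.1 ∈ Ioc a b
    · rw [indicator_of_mem (by simpa only [mem_ofPred_eq, h2] using h),
        indicator_of_mem (by exact h), smul_eq_mul]
    · rw [indicator_of_notMem (by simpa only [mem_ofPred_eq, h2] using h),
        indicator_of_notMem (by exact h), smul_zero]
  rw [setIntegral_congr_fun polarCoord.open_target.measurableSet h1, setIntegral_indicator hS]
  congr 2
  ext p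
  simp only [polarCoord_target, mem_inter_iff, mem_prod, mem_Ioi, mem_Ioc, mem_ofPred_eq]
  constructor
  · rintro ⟨⟨_, h2⟩, h3⟩
    exact ⟨h3, h2⟩
  · rintro ⟨h3, h2⟩
    exact ⟨⟨ha.trans_lt h3.1, h2⟩, h3⟩

theorem integrableOn_Ioc_prod_Ioo {g : ℝ × ℝ → ℝ} {a b c d : ℝ}
    (hg : ContinuousOn g (Icc a b ×ˢ Icc c d)) : IntegrableOn g (Ioc a b ×ˢ Ioo c d) :=
  (hg.integrableOn_compact (isCompact_Icc.prod isCompact_Icc)).mono_set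
    (prod_mono Ioc_subset_Icc_self Ioo_subset_Icc_self)

/-- The integral over a rectangle of a function of the first variable only. -/
theorem setIntegral_Ioc_prod_Ioo_pi {a b : ℝ} (hab : a ≤ b) (g : ℝ → ℝ) :
    ∫ p in Ioc a b ×ˢ Ioo (-Real.pi) Real.pi, g p.1 = 2 * Real.pi * ∫ r in a..b, g r := by
  have h := setIntegral_prod_mul (μ := (volume : Measure ℝ)) (ν := (volume : Measure ℝ)) g
    (fun _ => (1 : ℝ)) (Ioc a b) (Ioo (-Real.pi) Real.pi)
  simp only [mul_one] at h
  rw [Measure.volume_eq_prod, h, intervalIntegral.integral_of_le hab]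
  simp only [integral_const, MeasurableSet.univ, measureReal_restrict_apply, univ_inter,
    smul_eq_mul, mul_one]
  rw [Real.volume_real_Ioo_of_le (by linarith [Real.pi_pos])]
  ring

/-! ### Circle averages and the Dirichlet norm -/

theorem circleAverage_eq_integral_Ioo {φ : ℂ → ℝ} (z : ℂ) (r : ℝ) :
    2 * Real.pi * Real.circleAverage φ z r =
      ∫ θ in Ioo (-Real.pi) Real.pi, φ (circleMap z r θ) := by
  have hper : Function.Periodic (fun θ => φ (circleMap z r θ)) (2 * Real.pi) :=
    fun θ => by simp only [periodic_circleMap z r θ]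
  have h := hper.intervalIntegral_add_eq 0 (-Real.pi)
  rw [zero_add, show -Real.pi + 2 * Real.pi = Real.pi by ring] at h
  rw [Real.circleAverage, smul_eq_mul, mul_inv_cancel_left₀ (by positivity), h,
    intervalIntegral.integral_of_le (by linarith [Real.pi_pos]), integral_Ioc_eq_integral_Ioo]

theorem hasDerivAt_comp_circleMap {φ : ℂ → ℝ} (hφ : Differentiable ℝ φ) (z : ℂ) (r θ : ℝ) :
    HasDerivAt (fun r => φ (circleMap z r θ))
      (inner ℝ (∇ φ (circleMap z r θ)) (circleMap 0 1 θ)) r := by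
  have h1 : HasDerivAt (fun r : ℝ => circleMap z r θ) (circleMap 0 1 θ) r := by
    simp only [circleMap, Complex.ofReal_one, one_mul, zero_add]
    have := ((Complex.ofRealCLM.hasDerivAt (x := r)).mul_const
      (Complex.exp (θ * Complex.I))).const_add z
    simpa using this
  have h2 := (hφ (circleMap z r θ)).hasFDerivAt.comp_hasDerivAt r h1
  rw [inner_gradient_left]
  exact h2

theorem continuous_circleMap_uncurry (z : ℂ) :
    Continuous (fun p : ℝ × ℝ => circleMap z p.1 p.2) := by
  unfold circleMap
  fun_prop

/-- The difference of two circle averages is the integral of the radial derivative over the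
annulus between the circles. -/
theorem setIntegral_radial_gradient {φ : ℂ → ℝ} (hφ : ContDiff ℝ 1 φ) (z : ℂ) {a b : ℝ}
    (hab : a ≤ b) :
    ∫ p in Ioc a b ×ˢ Ioo (-Real.pi) Real.pi,
        inner ℝ (∇ φ (circleMap z p.1 p.2)) (circleMap 0 1 p.2) =
      2 * Real.pi * (Real.circleAverage φ z b - Real.circleAverage φ z a) := by
  have hgrad : Continuous (∇ φ) :=
    (InnerProductSpace.toDual ℝ ℂ).symm.continuous.comp (hφ.continuous_fderiv (by simp))
  have hcont : Continuous (fun p : ℝ × ℝ =>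
      inner ℝ (∇ φ (circleMap z p.1 p.2)) (circleMap 0 1 p.2)) :=
    (hgrad.comp (continuous_circleMap_uncurry z)).inner
      ((continuous_circleMap 0 1).comp continuous_snd)
  have hint := integrableOn_Ioc_prod_Ioo (a := a) (b := b) (c := -Real.pi) (d := Real.pi)
    hcont.continuousOn
  have hφc : ∀ r, IntegrableOn (fun θ => φ (circleMap z r θ)) (Ioo (-Real.pi) Real.pi) := fun r =>
    ((hφ.continuous.comp (continuous_circleMap z r)).integrableOn_Icc).mono_set Ioo_subset_Icc_self
  rw [mul_sub, circleAverage_eq_integral_Ioo, circleAverage_eq_integral_Ioo,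
    ← integral_sub (hφc b) (hφc a), Measure.volume_eq_prod, ← Measure.prod_restrict,
    integral_prod_symm]
  · refine integral_congr_ae (ae_of_all _ fun θ => ?_)
    simp only
    rw [← intervalIntegral.integral_of_le hab]
    exact intervalIntegral.integral_eq_sub_of_hasDerivAt
      (fun r _ => hasDerivAt_comp_circleMap (hφ.differentiable (by simp)) z r θ)
      ((hcont.comp (Continuous.prodMk_left θ)).intervalIntegrable _ _)
  · rwa [Measure.prod_restrict, ← Measure.volume_eq_prod]

/-- **Upper bound for the energy of the difference of two circles**, for `C¹` functions of finite
Dirichlet energy. -/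
theorem sq_circleAverage_sub_le {φ : ℂ → ℝ} (hφ : ContDiff ℝ 1 φ)
    (hint : Integrable (fun x => ‖∇ φ x‖ ^ 2)) (z : ℂ) {a b : ℝ} (ha : 0 < a) (hab : a < b) :
    2 * Real.pi * (Real.circleAverage φ z a - Real.circleAverage φ z b) ^ 2 ≤
      Real.log (b / a) * ∫ x, ‖∇ φ x‖ ^ 2 := by
  set S : Set (ℝ × ℝ) := Ioc a b ×ˢ Ioo (-Real.pi) Real.pi with hS
  set g : ℝ × ℝ → ℝ := fun p => inner ℝ (∇ φ (circleMap z p.1 p.2)) (circleMap 0 1 p.2) with hg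
  set Δ : ℝ := Real.circleAverage φ z b - Real.circleAverage φ z a with hΔ
  set T : ℝ := Real.log (b / a) with hT
  have hTpos : 0 < T := Real.log_pos ((one_lt_div ha).2 hab)
  have hSmeas : MeasurableSet S := measurableSet_Ioc.prod measurableSet_Ioo
  have hgrad : Continuous (∇ φ) :=
    (InnerProductSpace.toDual ℝ ℂ).symm.continuous.comp (hφ.continuous_fderiv (by simp))
  have hgc : Continuous (fun p : ℝ × ℝ => ∇ φ (circleMap z p.1 p.2)) :=
    hgrad.comp (continuous_circleMap_uncurry z)
  have hcont : Continuous g := hgc.inner ((continuous_circleMap 0 1).comp continuous_snd)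
  have hpos : ∀ p ∈ S, 0 < p.1 := fun p hp => ha.trans hp.1.1
  have i1 : IntegrableOn (fun p : ℝ × ℝ => p.1 * g p ^ 2) S :=
    integrableOn_Ioc_prod_Ioo (by fun_prop)
  have i1' : IntegrableOn (fun p : ℝ × ℝ => p.1 * ‖∇ φ (circleMap z p.1 p.2)‖ ^ 2) S :=
    integrableOn_Ioc_prod_Ioo (by fun_prop)
  have i2 : IntegrableOn g S := integrableOn_Ioc_prod_Ioo hcont.continuousOn
  have i3 : IntegrableOn (fun p : ℝ × ℝ => p.1⁻¹) S :=
    integrableOn_Ioc_prod_Ioo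
      (continuousOn_fst.inv₀ fun p hp => (ha.trans_le hp.1.1).ne')
  have e2 : ∫ p in S, g p = 2 * Real.pi * Δ := setIntegral_radial_gradient hφ z hab.le
  have e3 : ∫ p in S, (p : ℝ × ℝ).1⁻¹ = 2 * Real.pi * T := by
    rw [hS, setIntegral_Ioc_prod_Ioo_pi hab.le (fun r => r⁻¹),
      integral_inv_of_pos ha (ha.trans hab)]
  have e1 : ∫ p in S, p.1 * g p ^ 2 ≤ ∫ x, ‖∇ φ x‖ ^ 2 := by
    calc ∫ p in S, p.1 * g p ^ 2
        ≤ ∫ p in S, p.1 * ‖∇ φ (circleMap z p.1 p.2)‖ ^ 2 := by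
          refine setIntegral_mono_on i1 i1' hSmeas fun p hp => ?_
          have h1 : |g p| ≤ ‖∇ φ (circleMap z p.1 p.2)‖ := by
            refine (abs_real_inner_le_norm _ _).trans_eq ?_
            simp
          have h2 := sq_le_sq' (by linarith [abs_nonneg (g p), neg_abs_le (g p)])
            ((le_abs_self _).trans h1)
          exact mul_le_mul_of_nonneg_left h2 (hpos p hp).le
      _ = ∫ w in {w : ℂ | ‖w - z‖ ∈ Ioc a b}, ‖∇ φ w‖ ^ 2 :=
          (setIntegral_annulus_eq ha.le (fun w => ‖∇ φ w‖ ^ 2)).symm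
      _ ≤ ∫ x, ‖∇ φ x‖ ^ 2 := setIntegral_le_integral hint (ae_of_all _ fun x => by positivity)
  -- The radial derivative is compared with its least-energy profile `Δ / (T r)`.
  have hsq : 0 ≤ ∫ p in S, (p.1 * g p ^ 2 - 2 * (Δ / T) * g p + (Δ / T) ^ 2 * p.1⁻¹) := by
    refine setIntegral_nonneg hSmeas fun p hp => ?_
    have hp0 := hpos p hp
    have : p.1 * g p ^ 2 - 2 * (Δ / T) * g p + (Δ / T) ^ 2 * p.1⁻¹ =
        p.1 * (g p - Δ / T * p.1⁻¹) ^ 2 := by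
      field_simp
      ring
    rw [this]
    positivity
  have hsplit : ∫ p in S, (p.1 * g p ^ 2 - 2 * (Δ / T) * g p + (Δ / T) ^ 2 * p.1⁻¹) =
      (∫ p in S, p.1 * g p ^ 2) - 2 * (Δ / T) * (2 * Real.pi * Δ) +
        (Δ / T) ^ 2 * (2 * Real.pi * T) := by
    have i4 : IntegrableOn (fun p => p.1 * g p ^ 2 - 2 * (Δ / T) * g p) S :=
      i1.sub (i2.const_mul _)
    rw [integral_add i4 (i3.const_mul _), integral_sub i1 (i2.const_mul _),
      integral_const_mul, integral_const_mul, e2, e3]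
  have hfin : 2 * Real.pi * Δ ^ 2 / T ≤ ∫ x, ‖∇ φ x‖ ^ 2 := by
    have h : (2 * (Δ / T) * (2 * Real.pi * Δ) - (Δ / T) ^ 2 * (2 * Real.pi * T)) =
        2 * Real.pi * Δ ^ 2 / T := by
      field_simp
      ring
    linarith
  rw [div_le_iff₀ hTpos] at hfin
  rw [sub_sq_comm]
  linarith

namespace PlanarGFF

theorem integral_circleMeasure {φ : ℂ → ℝ} (hφ : Continuous φ) (z : ℂ) (ε : ℝ) :
    ∫ x, φ x ∂(circleMeasure z ε) = Real.circleAverage φ z ε := by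
  rw [circleMeasure, integral_smul_measure, integral_map (by fun_prop)
    hφ.aestronglyMeasurable, Real.circleAverage, ENNReal.toReal_ofReal (by positivity),
    intervalIntegral.integral_of_le (by positivity)]

variable {D : Set ℂ}

theorem TestFun.norm_sq_eq (φ : TestFun D) :
    ‖φ‖ ^ 2 = (2 * Real.pi)⁻¹ * ∫ x, ‖∇ ⇑φ x‖ ^ 2 := by
  rw [← real_inner_self_eq_norm_sq, TestFun.inner_eq,
    setIntegral_eq_integral_of_forall_compl_eq_zero]
  · simp only [real_inner_self_eq_norm_sq]
  · intro x hx
    simp [φ.gradient_eq_zero_of_notMem hx]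

theorem TestFun.integrable_norm_gradient_sq (φ : TestFun D) :
    Integrable (fun x => ‖∇ ⇑φ x‖ ^ 2) := by
  simpa only [real_inner_self_eq_norm_sq] using φ.integrable_inner_gradient φ

theorem TestFun.sq_circleAverage_sub_le (φ : TestFun D) (z : ℂ) {a b : ℝ} (ha : 0 < a)
    (hab : a < b) :
    (Real.circleAverage φ z a - Real.circleAverage φ z b) ^ 2 ≤ Real.log (b / a) * ‖φ‖ ^ 2 := by
  have h := _root_.sq_circleAverage_sub_le (φ.contDiff.of_le (by simp))
    φ.integrable_norm_gradient_sq z ha hab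
  rw [TestFun.norm_sq_eq, mul_left_comm, ← div_eq_inv_mul, le_div_iff₀ (by positivity)]
  linarith

end PlanarGFF

/-! ### Radial test functions -/

/-- A smooth truncation of `u ↦ 1 / (2u)` to the interval `(a, b)`, equal to it on all but a
prescribed part of the interval. -/
theorem exists_contDiff_le_inv {a b η : ℝ} (ha : 0 < a) (hη : 0 < η) (hab : a + 2 * η < b - 2 * η) :
    ∃ k : ℝ → ℝ, ContDiff ℝ (⊤ : ℕ∞) k ∧ (∀ u, 0 ≤ k u) ∧ (∀ u, 2 * u * k u ≤ 1) ∧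
      (∀ u, u ∉ Ioo (a + η) (b - η) → k u = 0) ∧
      ∀ u ∈ Icc (a + 2 * η) (b - 2 * η), k u = 2⁻¹ * u⁻¹ := by
  let χ : ContDiffBump ((a + b) / 2) :=
    ⟨(b - a) / 2 - 2 * η, (b - a) / 2 - η, by linarith, by linarith⟩
  have hzero : ∀ u, u ∉ Ioo (a + η) (b - η) → χ u = 0 := by
    intro u hu
    refine χ.zero_of_le_dist ?_
    by_contra! h
    rw [Real.dist_eq, abs_lt] at h
    change -((b - a) / 2 - η) < _ ∧ _ < (b - a) / 2 - η at h
    exact hu ⟨by linarith [h.1], by linarith [h.2]⟩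
  refine ⟨fun u => χ u * (2⁻¹ * u⁻¹), ?_, ?_, ?_, ?_, ?_⟩
  · rw [contDiff_iff_contDiffAt]
    intro u
    by_cases hu : u < a
    · refine (contDiffAt_const (c := (0 : ℝ))).congr_of_eventuallyEq ?_
      filter_upwards [gt_mem_nhds hu] with v hv
      rw [hzero v (fun h => by linarith [h.1]), zero_mul]
    · have hu0 : u ≠ 0 := by linarith
      exact χ.contDiffAt.mul (contDiffAt_const.mul (contDiffAt_inv ℝ hu0))
  · intro u
    by_cases hu : u ∈ Ioo (a + η) (b - η)
    · have : 0 < u := by linarith [hu.1]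
      have := χ.nonneg' u
      positivity
    · simp only [hzero u hu, zero_mul, le_refl]
  · intro u
    by_cases hu : u ∈ Ioo (a + η) (b - η)
    · have h0 : 0 < u := by linarith [hu.1]
      have h1 : 2 * u * (χ u * (2⁻¹ * u⁻¹)) = χ u := by field_simp
      rw [h1]
      exact χ.le_one
    · simp only [hzero u hu, zero_mul, mul_zero, zero_le_one]
  · intro u hu
    simp only [hzero u hu, zero_mul]
  · intro u hu
    have : χ u = 1 := by
      refine χ.one_of_mem_closedBall ?_
      rw [Metric.mem_closedBall, Real.dist_eq, abs_le]
      constructor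
      · show -((b - a) / 2 - 2 * η) ≤ _
        linarith [hu.1]
      · show _ ≤ (b - a) / 2 - 2 * η
        linarith [hu.2]
    simp only [this, one_mul]

theorem gradient_comp_norm_sub_sq {F : ℝ → ℝ} {z x : ℂ} {F' : ℝ}
    (hF : HasDerivAt F F' (‖x - z‖ ^ 2)) :
    ∇ (fun y => F (‖y - z‖ ^ 2)) x = (2 * F') • (x - z) := by
  have h1 : HasFDerivAt (fun y : ℂ => ‖y - z‖ ^ 2) (2 • innerSL ℝ (x - z)) x := by
    simpa using ((hasFDerivAt_id x).sub_const z).norm_sq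
  have h2 := hF.comp_hasFDerivAt x h1
  refine HasGradientAt.gradient (hasGradientAt_iff_hasFDerivAt.2 ?_)
  have h3 : InnerProductSpace.toDual ℝ ℂ ((2 * F') • (x - z)) =
      F' • 2 • innerSL ℝ (x - z) := by
    refine ContinuousLinearMap.ext fun w => ?_
    rw [InnerProductSpace.toDual_apply_apply, real_inner_smul_left]
    simp only [smul_apply, innerSL_apply_apply, smul_eq_mul, nsmul_eq_mul]
    push_cast
    ring
  rw [h3]
  exact h2

/-- The Dirichlet energy of a radial function `x ↦ F (‖x - z‖²)` whose derivative is supported in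
an annulus. -/
theorem integral_norm_gradient_radial_sq {F k : ℝ → ℝ} (hF : ∀ u, HasDerivAt F (-k u) u)
    (z : ℂ) {r R : ℝ} (hr : 0 ≤ r) (hrR : r ≤ R) (hk : ∀ u, u ∉ Ioc (r ^ 2) (R ^ 2) → k u = 0) :
    ∫ x, ‖∇ (fun y => F (‖y - z‖ ^ 2)) x‖ ^ 2 =
      2 * Real.pi * ∫ s in r..R, s * (4 * k (s ^ 2) ^ 2 * s ^ 2) := by
  have h1 : ∀ x, ‖∇ (fun y => F (‖y - z‖ ^ 2)) x‖ ^ 2 =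
      4 * k (‖x - z‖ ^ 2) ^ 2 * ‖x - z‖ ^ 2 := by
    intro x
    rw [gradient_comp_norm_sub_sq (hF _), norm_smul, mul_pow, Real.norm_eq_abs, sq_abs]
    ring
  have h2 : ∫ x in {w : ℂ | ‖w - z‖ ∈ Ioc r R}, 4 * k (‖x - z‖ ^ 2) ^ 2 * ‖x - z‖ ^ 2 =
      ∫ x, 4 * k (‖x - z‖ ^ 2) ^ 2 * ‖x - z‖ ^ 2 := by
    refine setIntegral_eq_integral_of_forall_compl_eq_zero fun x hx => ?_
    rw [hk, zero_pow two_ne_zero, mul_zero, zero_mul]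
    intro h
    exact hx ⟨lt_of_pow_lt_pow_left₀ 2 (norm_nonneg _) h.1,
      le_of_sq_le_sq h.2 (hr.trans hrR)⟩
  simp_rw [h1]
  rw [← h2, setIntegral_annulus_eq hr, ← setIntegral_Ioc_prod_Ioo_pi hrR]
  refine setIntegral_congr_fun (measurableSet_Ioc.prod measurableSet_Ioo) fun p hp => ?_
  simp only [circleMap_sub_center, norm_circleMap_zero, sq_abs]

namespace PlanarGFF

variable {D : Set ℂ}

theorem circleAverage_radial (F : ℝ → ℝ) (z : ℂ) (r : ℝ) :
    Real.circleAverage (fun y => F (‖y - z‖ ^ 2)) z r = F (r ^ 2) := by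
  refine Real.circleAverage_const_on_circle fun y hy => ?_
  rw [mem_sphere_iff_norm] at hy
  simp only [hy, sq_abs]

/-- **Radial test functions which nearly attain the energy of the difference of two circles**,
even if the outer circle touches the boundary of `D`. They approximate, on the logarithmic scale,
the function `x ↦ min (log (b / a)) (log⁺ (b / |x - z|))`. -/
theorem TestFun.exists_norm_sq_le_circleAverage_sub {z : ℂ} {a b T : ℝ} (ha : 0 < a) (hab : a < b)
    (hD : Metric.ball z b ⊆ D) (hT : T < Real.log (b / a)) :
    ∃ φ : TestFun D, T ≤ Real.circleAverage φ z a - Real.circleAverage φ z b ∧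
      ‖φ‖ ^ 2 ≤ Real.circleAverage φ z a - Real.circleAverage φ z b := by
  have hb : 0 < b := ha.trans hab
  -- A margin `η`, in the variable `‖x - z‖²`, which costs less than the gap `log (b / a) - T`.
  obtain ⟨η, hη0, hη1, hη2⟩ : ∃ η : ℝ, 0 < η ∧ a ^ 2 + 2 * η < b ^ 2 - 2 * η ∧
      T < 2⁻¹ * Real.log ((b ^ 2 - 2 * η) / (a ^ 2 + 2 * η)) := by
    have hlim1 : ContinuousAt (fun η : ℝ => (b ^ 2 - 2 * η) - (a ^ 2 + 2 * η)) 0 := by fun_prop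
    have hlim2 : ContinuousAt
        (fun η : ℝ => 2⁻¹ * Real.log ((b ^ 2 - 2 * η) / (a ^ 2 + 2 * η))) 0 := by
      refine continuousAt_const.mul (ContinuousAt.log (ContinuousAt.div (by fun_prop)
        (by fun_prop) ?_) ?_)
      · simp [ha.ne']
      · simp [ha.ne', hb.ne']
    have h0 : (0 : ℝ) < (b ^ 2 - 2 * 0) - (a ^ 2 + 2 * 0) := by
      nlinarith
    have h1 : T < 2⁻¹ * Real.log ((b ^ 2 - 2 * 0) / (a ^ 2 + 2 * 0)) := by
      rw [mul_zero, sub_zero, add_zero, ← div_pow, Real.log_pow]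
      push_cast
      linarith
    have e1 := (hlim1.eventually (lt_mem_nhds h0)).and (hlim2.eventually (lt_mem_nhds h1))
    obtain ⟨η, ⟨h2, h3⟩, h4⟩ :=
      ((e1.filter_mono nhdsWithin_le_nhds).and (self_mem_nhdsWithin (s := Ioi (0 : ℝ)))).exists
    exact ⟨η, h4, by linarith, h3⟩
  obtain ⟨k, hk, hk0, hk1, hksupp, hkeq⟩ := exists_contDiff_le_inv (pow_pos ha 2) hη0 hη1
  let F : ℝ → ℝ := fun q => -∫ u in (b ^ 2)..q, k u
  have hkint : ∀ p q, IntervalIntegrable k volume p q := fun p q =>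
    hk.continuous.intervalIntegrable p q
  have hF : ∀ u, HasDerivAt F (-k u) u := fun u =>
    (intervalIntegral.integral_hasDerivAt_right (hkint _ _)
      (hk.continuous.stronglyMeasurableAtFilter _ _) hk.continuous.continuousAt).neg
  have hFsmooth : ContDiff ℝ (⊤ : ℕ∞) F := by
    rw [contDiff_infty_iff_deriv]
    refine ⟨fun u => (hF u).differentiableAt, ?_⟩
    rw [show deriv F = fun u => -k u from funext fun u => (hF u).deriv]
    exact hk.neg
  have hFzero : ∀ q, b ^ 2 - η ≤ q → F q = 0 := by
    intro q hq
    have : ∫ u in (b ^ 2)..q, k u = ∫ u in (b ^ 2)..q, (0 : ℝ) := by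
      refine intervalIntegral.integral_congr fun u hu => hksupp u fun h => ?_
      have h1 : min (b ^ 2) q ≤ u := hu.1
      have h2 : b ^ 2 - η ≤ min (b ^ 2) q := le_min (by linarith) hq
      linarith [h.2]
    simp [F, this]
  let φ₀ : ℂ → ℝ := fun y => F (‖y - z‖ ^ 2)
  have hρ : 0 < b ^ 2 - η := by nlinarith
  have hsupp : tsupport φ₀ ⊆ Metric.closedBall z √(b ^ 2 - η) := by
    refine closure_minimal (fun x hx => ?_) Metric.isClosed_closedBall
    rw [Metric.mem_closedBall, dist_eq_norm]
    by_contra! h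
    refine hx (hFzero _ ?_)
    exact ((Real.sqrt_lt' (by linarith [Real.sqrt_nonneg (b ^ 2 - η)])).1 h).le
  have hball : Metric.closedBall z √(b ^ 2 - η) ⊆ D := by
    refine (Metric.closedBall_subset_ball ?_).trans hD
    rw [Real.sqrt_lt' hb]
    linarith
  have hsmooth : ContDiff ℝ (⊤ : ℕ∞) φ₀ :=
    hFsmooth.comp ((contDiff_id.sub contDiff_const).norm_sq ℝ)
  let φ : TestFun D := ⟨φ₀, hsmooth,
    HasCompactSupport.of_support_subset_isCompact (isCompact_closedBall z √(b ^ 2 - η))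
      ((subset_tsupport _).trans hsupp), hsupp.trans hball⟩
  have hφ : (φ : ℂ → ℝ) = fun y => F (‖y - z‖ ^ 2) := rfl
  have hA : Real.circleAverage φ z a - Real.circleAverage φ z b = ∫ u in (a ^ 2)..(b ^ 2), k u := by
    rw [hφ, circleAverage_radial, circleAverage_radial, hFzero (b ^ 2) (by linarith), sub_zero,
      intervalIntegral.integral_symm (b ^ 2)]
  refine ⟨φ, ?_, ?_⟩
  · rw [hA]
    have h1 : ∫ u in (a ^ 2 + 2 * η)..(b ^ 2 - 2 * η), k u =
        2⁻¹ * Real.log ((b ^ 2 - 2 * η) / (a ^ 2 + 2 * η)) := by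
      rw [← integral_inv_of_pos (by positivity) (by nlinarith),
        ← intervalIntegral.integral_const_mul]
      refine intervalIntegral.integral_congr fun u hu => hkeq u ?_
      rwa [uIcc_of_le hη1.le] at hu
    refine hη2.le.trans (h1.symm.trans_le ?_)
    exact intervalIntegral.integral_mono_interval (by linarith) hη1.le (by linarith)
      (ae_of_all _ hk0) (hkint _ _)
  · rw [hA, TestFun.norm_sq_eq, hφ, integral_norm_gradient_radial_sq hF z ha.le hab.le
      fun u hu => hksupp u fun h => hu ⟨by linarith [h.1], by linarith [h.2]⟩,
      inv_mul_cancel_left₀ (by positivity)]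
    -- The right-hand side is transformed by `u = s²`.
    have hsub : ∫ s in a..b, 2 * s * k (s ^ 2) = ∫ u in (a ^ 2)..(b ^ 2), k u := by
      have h := intervalIntegral.integral_comp_mul_deriv (a := a) (b := b) (f := fun s => s ^ 2)
        (f' := fun s => 2 * s) (g := k) (fun s _ => by simpa using hasDerivAt_pow 2 s)
        (by fun_prop) hk.continuous
      rw [← h]
      refine intervalIntegral.integral_congr fun s _ => ?_
      simp [mul_comm]
    rw [← hsub]
    have hkc := hk.continuous
    refine intervalIntegral.integral_mono_on hab.le
      (Continuous.intervalIntegrable (by fun_prop) _ _)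
      (Continuous.intervalIntegrable (by fun_prop) _ _) fun s hs => ?_
    have hs0 : 0 ≤ s := ha.le.trans hs.1
    calc s * (4 * k (s ^ 2) ^ 2 * s ^ 2)
        = (2 * s * k (s ^ 2)) * (2 * s ^ 2 * k (s ^ 2)) := by ring
      _ ≤ (2 * s * k (s ^ 2)) * 1 := by
        refine mul_le_mul_of_nonneg_left (hk1 _) ?_
        have := hk0 (s ^ 2)
        positivity
      _ = 2 * s * k (s ^ 2) := mul_one _

end PlanarGFF

namespace PlanarGFF

variable {D : Set ℂ}

/-! ### The potentials of circles -/

theorem TestFun.continuous (φ : TestFun D) : Continuous φ := φ.contDiff.continuous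

theorem TestFun.circleIntegrable (φ : TestFun D) (z : ℂ) (r : ℝ) : CircleIntegrable φ z r :=
  φ.continuous.continuousOn.circleIntegrable'

theorem TestFun.circleAverage_eq_zero (φ : TestFun D) {z : ℂ} {r : ℝ} (hr : 0 ≤ r)
    (hD : D ⊆ Metric.ball z r) : Real.circleAverage φ z r = 0 := by
  refine Real.circleAverage_const_on_circle fun x hx => ?_
  refine image_eq_zero_of_notMem_tsupport fun h => ?_
  have h1 := hD (φ.tsupport_subset h)
  rw [abs_of_nonneg hr, mem_sphere_iff_norm] at hx
  rw [Metric.mem_ball, dist_eq_norm, hx] at h1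
  exact lt_irrefl _ h1

/-- Circles of every positive radius have finite energy, including those which meet the boundary of
the bounded set `D`. -/
theorem exists_isNegInvLaplacian_circleMeasure (hD : Bornology.IsBounded D) (z : ℂ) {ε : ℝ}
    (hε : 0 < ε) : ∃ f : DirichletSpace D, IsNegInvLaplacian (circleMeasure z ε) f := by
  obtain ⟨M, hεM, hM⟩ := hD.subset_ball_lt ε z
  let ℓ : TestFun D →ₗ[ℝ] ℝ :=
    { toFun := fun φ => Real.circleAverage φ z ε
      map_add' := fun φ ψ => by
        rw [TestFun.coe_add]
        exact Real.circleAverage_add (φ.circleIntegrable z ε) (ψ.circleIntegrable z ε)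
      map_smul' := fun c φ => by
        rw [TestFun.coe_smul]
        exact Real.circleAverage_smul }
  -- Compare with a circle outside `D`, where test functions vanish.
  have hbound : ∀ φ : TestFun D, ‖ℓ φ‖ ≤ √(Real.log (M / ε)) * ‖φ‖ := by
    intro φ
    have h := φ.sq_circleAverage_sub_le z hε hεM
    rw [φ.circleAverage_eq_zero (hε.trans hεM).le hM, sub_zero] at h
    rw [Real.norm_eq_abs]
    refine Real.abs_le_sqrt h |>.trans_eq ?_
    rw [Real.sqrt_mul' _ (sq_nonneg _), Real.sqrt_sq (norm_nonneg _)]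
  let L : DirichletSpace D →L[ℝ] ℝ :=
    ℓ.extendOfNorm (UniformSpace.Completion.toComplL (𝕜 := ℝ) (E := TestFun D)).toLinearMap
  have hL : ∀ φ : TestFun D, L (φ : DirichletSpace D) = Real.circleAverage φ z ε := fun φ =>
    LinearMap.extendOfNorm_eq (f := ℓ)
      (e := (UniformSpace.Completion.toComplL (𝕜 := ℝ) (E := TestFun D)).toLinearMap)
      UniformSpace.Completion.denseRange_coe
      ⟨_, fun φ => (hbound φ).trans_eq (by
        rw [← UniformSpace.Completion.norm_coe φ]
        rfl)⟩ φ
  refine ⟨(2 * Real.pi)⁻¹ • (InnerProductSpace.toDual ℝ (DirichletSpace D)).symm L, fun φ => ?_⟩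
  rw [real_inner_smul_left, mul_inv_cancel_left₀ (by positivity),
    InnerProductSpace.toDual_symm_apply, hL, integral_circleMeasure φ.continuous]

/-- `2π (-Δ⁻¹ ρ)` for the uniform probability measure `ρ` on the circle of radius `e⁻ᵗ` about `z`.
With this factor, its Dirichlet inner product with a test function is the mean of that function on
the circle. -/
noncomputable def circlePotential (D : Set ℂ) (z : ℂ) (t : ℝ) : DirichletSpace D :=
  (2 * Real.pi) • negInvLaplacian D (circleMeasure z (Real.exp (-t)))

theorem inner_circlePotential (hD : Bornology.IsBounded D) (z : ℂ) (t : ℝ) (φ : TestFun D) :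
    inner ℝ (circlePotential D z t) (φ : DirichletSpace D) =
      Real.circleAverage φ z (Real.exp (-t)) := by
  have hex := exists_isNegInvLaplacian_circleMeasure hD z (Real.exp_pos (-t))
  have h : IsNegInvLaplacian (circleMeasure z (Real.exp (-t)))
      (negInvLaplacian D (circleMeasure z (Real.exp (-t)))) := by
    rw [negInvLaplacian, dif_pos hex]
    exact hex.choose_spec
  rw [circlePotential, real_inner_smul_left, h φ, integral_circleMeasure φ.continuous]

/-- The potentials of two concentric circles inside `D` differ by an element of `H(D)` whose
squared norm is the logarithm of the ratio of the radii. -/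
theorem norm_circlePotential_sub_sq (hD : Bornology.IsBounded D) {z : ℂ} {s t : ℝ} (hst : s ≤ t)
    (hs : Metric.ball z (Real.exp (-s)) ⊆ D) :
    ‖circlePotential D z t - circlePotential D z s‖ ^ 2 = t - s := by
  rcases hst.eq_or_lt with rfl | hlt
  · simp
  set w := circlePotential D z t - circlePotential D z s with hw
  have hexp : Real.exp (-t) < Real.exp (-s) := Real.exp_lt_exp.2 (by linarith)
  have hlog : Real.log (Real.exp (-s) / Real.exp (-t)) = t - s := by
    rw [← Real.exp_sub, Real.log_exp]
    ring
  have hinner : ∀ φ : TestFun D, inner ℝ w (φ : DirichletSpace D) =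
      Real.circleAverage φ z (Real.exp (-t)) - Real.circleAverage φ z (Real.exp (-s)) := by
    intro φ
    rw [hw, inner_sub_left, inner_circlePotential hD, inner_circlePotential hD]
  apply le_antisymm
  -- Both bounds are by duality with test functions, which are dense.
  · have hall : ∀ v : DirichletSpace D, inner ℝ w v ^ 2 ≤ (t - s) * ‖v‖ ^ 2 := by
      intro v
      induction v using UniformSpace.Completion.induction_on with
      | hp => exact isClosed_le (by fun_prop) (by fun_prop)
      | ih φ =>
        rw [hinner, UniformSpace.Completion.norm_coe, ← hlog]
        exact φ.sq_circleAverage_sub_le z (Real.exp_pos _) hexp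
    have h := hall w
    rw [real_inner_self_eq_norm_sq] at h
    by_contra! hcon
    nlinarith [sq_nonneg ‖w‖]
  · refine le_of_forall_lt fun T hT => ?_
    obtain ⟨T', hT1, hT2⟩ := exists_between (max_lt hT (sub_pos.2 hlt))
    obtain ⟨φ, hφ1, hφ2⟩ := TestFun.exists_norm_sq_le_circleAverage_sub (Real.exp_pos _) hexp hs
      (hT2.trans_eq hlog.symm)
    rw [← hinner] at hφ1 hφ2
    have hpos : 0 < inner ℝ w (φ : DirichletSpace D) :=
      ((le_max_right _ _).trans_lt hT1).trans_le hφ1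
    have hcs := real_inner_le_norm w (φ : DirichletSpace D)
    rw [UniformSpace.Completion.norm_coe] at hcs
    have hcs2 := pow_le_pow_left₀ hpos.le hcs 2
    rw [mul_pow] at hcs2
    have h2 : inner ℝ w (φ : DirichletSpace D) ^ 2 ≤
        ‖w‖ ^ 2 * inner ℝ w (φ : DirichletSpace D) :=
      hcs2.trans (mul_le_mul_of_nonneg_left hφ2 (sq_nonneg _))
    have h3 : inner ℝ w (φ : DirichletSpace D) ≤ ‖w‖ ^ 2 := by
      rw [sq] at h2
      exact le_of_mul_le_mul_right h2 hpos
    exact ((le_max_left _ _).trans_lt hT1).trans_le (hφ1.trans h3)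

/-- The covariance of the increments of the circle means, by polarization. -/
theorem inner_circlePotential_sub (hD : Bornology.IsBounded D) {z : ℂ} {r s t : ℝ} (hrs : r ≤ s)
    (hst : s ≤ t) (hr : Metric.ball z (Real.exp (-r)) ⊆ D) :
    inner ℝ (circlePotential D z s - circlePotential D z r)
      (circlePotential D z t - circlePotential D z r) = s - r := by
  have hs : Metric.ball z (Real.exp (-s)) ⊆ D :=
    (Metric.ball_subset_ball (Real.exp_le_exp.2 (by linarith))).trans hr
  have h1 := norm_circlePotential_sub_sq hD hrs hr
  have h2 := norm_circlePotential_sub_sq hD (hrs.trans hst) hr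
  have h3 := norm_circlePotential_sub_sq hD hst hs
  have h4 := norm_sub_sq_real (circlePotential D z t - circlePotential D z r)
    (circlePotential D z s - circlePotential D z r)
  rw [sub_sub_sub_cancel_right, h1, h2, h3, real_inner_comm] at h4
  linarith

/-- The infimum defining `t₀` is attained, since an open ball is the union of the smaller ones. -/
theorem ball_exp_neg_firstTime_subset (hDopen : IsOpen D) {z : ℂ}
    (hz : z ∈ D) : Metric.ball z (Real.exp (-firstTime D z)) ⊆ D := by
  have hne : {t : ℝ | Metric.ball z (Real.exp (-t)) ⊆ D}.Nonempty := by
    obtain ⟨r, hr, hball⟩ := Metric.isOpen_iff.1 hDopen z hz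
    exact ⟨-Real.log r, by rwa [mem_ofPred_eq, neg_neg, Real.exp_log hr]⟩
  intro x hx
  rw [Metric.mem_ball] at hx
  have hcont : ContinuousAt (fun t => Real.exp (-t)) (firstTime D z) := by fun_prop
  obtain ⟨δ, hδ, hδx⟩ := Metric.eventually_nhds_iff.1 (hcont.eventually (lt_mem_nhds hx))
  obtain ⟨t, ht, htδ⟩ := exists_lt_of_csInf_lt hne
    (show sInf _ < firstTime D z + δ from lt_add_of_pos_right _ hδ)
  by_cases hle : firstTime D z ≤ t
  · refine ht (Metric.mem_ball.2 (hδx ?_))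
    rw [Real.dist_eq, abs_lt]
    constructor <;> linarith
  · refine ht (Metric.mem_ball.2 (hx.trans ?_))
    exact Real.exp_lt_exp.2 (by linarith)

/-! ### The circle average process -/

section

variable {Ω : Type*} [MeasurableSpace Ω] {P : Measure Ω} {h : DirichletSpace D → Ω → ℝ}

/-- The increments of `t ↦ h_{e⁻ᵗ}(z)` from a time `r` at which the circle bounds a disc inside `D`
form a pre-Brownian motion. -/
theorem IsGFF.isPreBrownianReal_circleMean (hh : IsGFF h P) (hD : Bornology.IsBounded D) {z : ℂ}
    {r : ℝ} (hr : Metric.ball z (Real.exp (-r)) ⊆ D) :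
    IsPreBrownianReal (fun (t : ℝ≥0) ω =>
      circleMean h z (Real.exp (-(r + t))) ω - circleMean h z (Real.exp (-r)) ω) P := by
  classical
  have hprob := hh.gaussian.isProbabilityMeasure
  let f : ℝ → DirichletSpace D := fun t => negInvLaplacian D (circleMeasure z (Real.exp (-t)))
  have hL2 : ∀ g, MemLp (h g) 2 P := fun g => (hh.gaussian.hasGaussianLaw_eval g).memLp_two
  have hint : ∀ g, Integrable (h g) P := fun g => (hL2 g).integrable (by norm_num)
  have hX : ∀ (t : ℝ≥0), (fun ω => circleMean h z (Real.exp (-(r + t))) ω -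
      circleMean h z (Real.exp (-r)) ω) =
      fun ω => 2 * Real.pi * (h (f (r + t)) ω - h (f r) ω) := by
    intro t
    ext ω
    exact (mul_sub _ _ _).symm
  refine IsGaussianProcess.isPreBrownianReal_of_covariance ?_ (fun t => ?_) (fun s t hst => ?_)
  · refine hh.gaussian.of_isGaussianProcess fun t => ⟨{f (r + t), f r},
      (2 * Real.pi) • (ContinuousLinearMap.proj ⟨f (r + t), by simp⟩ -
        ContinuousLinearMap.proj ⟨f r, by simp⟩), fun ω => ?_⟩
    exact congrFun (hX t) ω
  · rw [hX, integral_const_mul, integral_sub (hint _) (hint _), hh.mean_zero, hh.mean_zero,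
      sub_zero, mul_zero]
  · rw [hX, hX, covariance_const_mul_left, covariance_const_mul_right,
      covariance_fun_sub_fun_sub (hL2 _) (hL2 _) (hL2 _) (hL2 _)]
    have e : ∀ a b, cov[fun ω => h a ω, fun ω => h b ω; P] = inner ℝ a b := hh.covariance
    simp only [e, f]
    have h1 := inner_circlePotential_sub hD (z := z) (r := r) (s := r + s) (t := r + t)
      (by simp) (by simpa using hst) hr
    simp only [circlePotential, ← smul_sub, real_inner_smul_left, real_inner_smul_right,
      inner_sub_left, inner_sub_right] at h1
    rw [add_sub_cancel_left] at h1
    refine Eq.trans ?_ h1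
    ring

end

end PlanarGFF

theorem proposition3p3 {D : Set ℂ} (hDopen : IsOpen D) (hDconn : IsConnected D)
    (hDbdd : Bornology.IsBounded D)
    {Ω : Type*} [MeasurableSpace Ω] (P : Measure Ω)
    (h : PlanarGFF.DirichletSpace D → Ω → ℝ) (hh : PlanarGFF.IsGFF h P)
    (z : ℂ) (hz : z ∈ D) :
    (∃ 𝒱 : ℝ → Ω → ℝ, PlanarGFF.IsCircleMeanVersion h P z 𝒱 ∧
      (∀ ω, ContinuousOn (fun t => 𝒱 t ω) (Ici (PlanarGFF.firstTime D z))) ∧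
      IsBrownianReal (fun (t : ℝ≥0) ω =>
        𝒱 (PlanarGFF.firstTime D z + t) ω - 𝒱 (PlanarGFF.firstTime D z) ω) P) ∧
    ∀ 𝒱 : ℝ → Ω → ℝ, PlanarGFF.IsCircleMeanVersion h P z 𝒱 →
      IsPreBrownianReal (fun (t : ℝ≥0) ω =>
        𝒱 (PlanarGFF.firstTime D z + t) ω - 𝒱 (PlanarGFF.firstTime D z) ω) P ∧
      ((∀ᵐ ω ∂P, ContinuousOn (fun t => 𝒱 t ω) (Ici (PlanarGFF.firstTime D z))) →
        IsBrownianReal (fun (t : ℝ≥0) ω =>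
          𝒱 (PlanarGFF.firstTime D z + t) ω - 𝒱 (PlanarGFF.firstTime D z) ω) P) := by
  set t₀ := PlanarGFF.firstTime D z with ht₀
  have hpre := hh.isPreBrownianReal_circleMean hDbdd
    (PlanarGFF.ball_exp_neg_firstTime_subset hDopen hz)
  rw [← ht₀] at hpre
  have hsecond : ∀ 𝒱 : ℝ → Ω → ℝ, PlanarGFF.IsCircleMeanVersion h P z 𝒱 →
      IsPreBrownianReal (fun (t : ℝ≥0) ω => 𝒱 (t₀ + t) ω - 𝒱 t₀ ω) P ∧
      ((∀ᵐ ω ∂P, ContinuousOn (fun t => 𝒱 t ω) (Ici t₀)) →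
        IsBrownianReal (fun (t : ℝ≥0) ω => 𝒱 (t₀ + t) ω - 𝒱 t₀ ω) P) := by
    intro 𝒱 h𝒱
    have hp : IsPreBrownianReal (fun (t : ℝ≥0) ω => 𝒱 (t₀ + t) ω - 𝒱 t₀ ω) P := by
      refine hpre.congr fun t => ?_
      filter_upwards [h𝒱 (t₀ + t), h𝒱 t₀] with ω h1 h2
      rw [h1, h2]
    refine ⟨hp, fun hc => ⟨hp, ?_⟩⟩
    filter_upwards [hc] with ω hω
    exact (hω.comp_continuous (f := fun t : ℝ≥0 => t₀ + (t : ℝ)) (by fun_prop)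
      fun t => by simp).sub continuous_const
  refine ⟨?_, hsecond⟩
  -- Before time `t₀` the circle means are kept as they are.
  obtain ⟨Y, hYc, hY⟩ := hpre.exists_continuous_modification
  let 𝒱 : ℝ → Ω → ℝ := fun t ω =>
    if t₀ ≤ t then Y (t - t₀).toNNReal ω + PlanarGFF.circleMean h z (Real.exp (-t₀)) ω
    else PlanarGFF.circleMean h z (Real.exp (-t)) ω
  have h𝒱 : PlanarGFF.IsCircleMeanVersion h P z 𝒱 := by
    intro t
    by_cases ht : t₀ ≤ t
    · filter_upwards [hY (t - t₀).toNNReal] with ω hω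
      simp only [𝒱, if_pos ht]
      rw [hω, Real.coe_toNNReal _ (sub_nonneg.2 ht), add_sub_cancel, sub_add_cancel]
    · filter_upwards with ω
      simp only [𝒱, if_neg ht]
  have hc : ∀ ω, ContinuousOn (fun t => 𝒱 t ω) (Ici t₀) := by
    intro ω
    have h1 : Continuous fun t : ℝ =>
        Y (t - t₀).toNNReal ω + PlanarGFF.circleMean h z (Real.exp (-t₀)) ω :=
      ((hYc ω).comp (by fun_prop)).add continuous_const
    exact h1.continuousOn.congr fun t ht => if_pos ht
  exact ⟨𝒱, h𝒱, hc, (hsecond 𝒱 h𝒱).2 (ae_of_all _ hc)⟩
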